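/- Let $\kappa\in[0,1)$. Consider quantum strategies consisting of complex Hilbert spaces $\mathcal H_A,\mathcal H_B$ of arbitrary dimension, a (possibly mixed) state $\rho$ on $\mathcal H_A\otimes\mathcal H_B$, two-outcome POVMs $\{E_x^a\}_{a\in\{0,1\}}$ on $\mathcal H_A$ for each input $x\in\{0,1\}$ of Alice, and two-outcome POVMs $\{\Pi_{y,x}^b\}_{b\in\{0,1\}}$ on $\mathcal H_B$, which may depend on Bob's input $y\in\{0,1\}$ and also on Alice's input $x\in\{0,1\}$. Put $A_x=\sum_a(-1)^aE_x^a$, $B_{y,x}=\sum_b(-1)^b\Pi_{y,x}^b$, $p(a,b|x,y)=\operatorname{Tr}\big(\rho\,(E_x^a\otimes \Pi_{y,x}^b)\big)$ and $\langle A_xB_{y,x}\rangle=\sum_{a,b}(-1)^{a+b}p(a,b|x,y)$. Suppose that the leakage of Alice's input is bounded, in operator norm, by $$\|B_{y,0}-B_{y,1}\|\le 2\kappa\qquad (y\in\{0,1\}).$$ Then the maximum over all such strategies of the CHSH expression $$S_{\mathrm{CHSH}}=\langle A_0B_{0,0}\rangle+\langle A_0B_{1,0}\rangle+\langle A_1B_{0,1}\rangle-\langle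 A_1B_{1,1}\rangle$$ exists and equals $$S_{q,\kappa}=\begin{cases}2\sqrt2\,\big(\kappa+\sqrt{1-\kappa^2}\big), & \kappa\in[0,\tfrac1{\sqrt2}],\\ 4,& \kappa\in[\tfrac1{\sqrt2},1).\end{cases}$$ It is attained by the two-qubit state $|\psi\rangle=\frac1{\sqrt2}(|00\rangle+|11\rangle)$ with $A_0=\sigma_z$, $A_1=\sigma_x$ and the following observables of Bob, which satisfy the leakage constraint. For $\kappa\in[0,\frac1{\sqrt2}]$: $$B_{0,0}=\tfrac{-\kappa+\sqrt{1-\kappa^2}}{\sqrt2}\sigma_x+\tfrac{\kappa+\sqrt{1-\kappa^2}}{\sqrt2}\sigma_z,\qquad B_{0,1}=\tfrac{\kappa+\sqrt{1-\kappa^2}}{\sqrt2}\sigma_x+\tfrac{-\kappa+\sqrt{1-\kappa^2}}{\sqrt2}\sigma_z,$$ $$B_{1,0}=\tfrac{\kappa-\sqrt{1-\kappa^2}}{\sqrt2}\sigma_x+\tfrac{\kappa+\sqrt{1-\kappa^2}}{\sqrt2}\sigma_z,\qquad B_{1,1}=\tfrac{-\kappa-\sqrt{1-\kappa^2}}{\sqrt2}\sigma_x+\tfrac{-\kappa+\sqrt{1-\kappa^2}}{\sqrt2}\sigma_z.$$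 For $\kappa\in[\frac1{\sqrt2},1)$: $B_{0,0}=\sigma_z$, $B_{0,1}=\sigma_x$, $B_{1,0}=\sigma_z$, $B_{1,1}=-\sigma_x$. -/

import Mathlib

open scoped TensorProduct InnerProductSpace

universe u v

noncomputable section

namespace LeakyCHSH

/-- The composite Hilbert space of two systems: the completion of the algebraic tensor product. -/
abbrev HilbertTensor (HA : Type u) (HB : Type v)
    [NormedAddCommGroup HA] [InnerProductSpace ℂ HA]
    [NormedAddCommGroup HB] [InnerProductSpace ℂ HB] : Type (max u v) :=
  UniformSpace.Completion (HA ⊗[ℂ] HB)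

/-- The bounded operator `S ⊗ T` on the composite Hilbert space. -/
def opTensor {HA : Type u} {HB : Type v}
    [NormedAddCommGroup HA] [InnerProductSpace ℂ HA]
    [NormedAddCommGroup HB] [InnerProductSpace ℂ HB]
    (S : HA →L[ℂ] HA) (T : HB →L[ℂ] HB) : HilbertTensor HA HB →L[ℂ] HilbertTensor HA HB :=
  (TensorProduct.mapL S T).completion

/-- A (mixed) quantum state `ρ = ∑ₖ pₖ |ψₖ⟩⟨ψₖ|`, with unit vectors `ψₖ` and a probability
distribution `p`. By the spectral theorem every density operator (positive, trace class, of
trace one) on a Hilbert space of any dimension is of this form. -/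
structure MixedState (H : Type u) [NormedAddCommGroup H] [InnerProductSpace ℂ H] where
  weight : ℕ → ℝ
  vec : ℕ → H
  weight_nonneg : ∀ k, 0 ≤ weight k
  hasSum_weight : HasSum weight 1
  norm_vec : ∀ k, ‖vec k‖ = 1

/-- The expectation `Tr (ρ T) = ∑ₖ pₖ ⟨ψₖ, T ψₖ⟩` of an observable `T` (its real part, which is
all of it for self-adjoint `T`). The series converges absolutely, as `|⟨ψₖ, T ψₖ⟩| ≤ ‖T‖`. -/
def MixedState.expect {H : Type u} [NormedAddCommGroup H] [InnerProductSpace ℂ H]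
    (ρ : MixedState H) (T : H →L[ℂ] H) : ℝ :=
  ∑' k, ρ.weight k * (⟪ρ.vec k, T (ρ.vec k)⟫_ℂ).re

/-- The pure state `|ψ⟩⟨ψ|` of a unit vector `ψ`. -/
def MixedState.pure {H : Type u} [NormedAddCommGroup H] [InnerProductSpace ℂ H]
    (ψ : H) (hψ : ‖ψ‖ = 1) : MixedState H where
  weight := Pi.single 0 1
  vec := fun _ => ψ
  weight_nonneg := fun k => by
    by_cases h : k = 0
    · subst h; simp
    · simp [h]
  hasSum_weight := hasSum_pi_single 0 1
  norm_vec := fun _ => hψ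

/-- A two-outcome POVM. -/
structure BinaryPOVM (H : Type u) [NormedAddCommGroup H] [InnerProductSpace ℂ H] where
  effect : Fin 2 → H →L[ℂ] H
  isPositive_effect : ∀ b, (effect b).IsPositive
  sum_effect : ∑ b, effect b = 1

/-- The observable `∑_b (-1)^b Π^b` of a two-outcome POVM `Π`. -/
def BinaryPOVM.observable {H : Type u} [NormedAddCommGroup H] [InnerProductSpace ℂ H]
    (P : BinaryPOVM H) : H →L[ℂ] H :=
  ∑ b : Fin 2, (-1 : ℂ) ^ (b : ℕ) • P.effect b

/-- A quantum strategy in which Bob's measurement `bob y x` may depend on his own input `y` and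
on Alice's input `x`. -/
structure Strategy (HA : Type u) (HB : Type v)
    [NormedAddCommGroup HA] [InnerProductSpace ℂ HA]
    [NormedAddCommGroup HB] [InnerProductSpace ℂ HB] where
  state : MixedState (HilbertTensor HA HB)
  alice : Fin 2 → BinaryPOVM HA
  bob : Fin 2 → Fin 2 → BinaryPOVM HB

namespace Strategy

variable {HA : Type u} {HB : Type v}
  [NormedAddCommGroup HA] [InnerProductSpace ℂ HA]
  [NormedAddCommGroup HB] [InnerProductSpace ℂ HB]

/-- The probability `p(a,b|x,y)`. -/
def prob (S : Strategy HA HB) (a b x y : Fin 2) : ℝ :=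
  S.state.expect (opTensor ((S.alice x).effect a) ((S.bob y x).effect b))

/-- The correlator `⟨A_x B_{y,x}⟩ = ∑_{a,b} (-1)^(a+b) p(a,b|x,y)`. -/
def correlator (S : Strategy HA HB) (x y : Fin 2) : ℝ :=
  ∑ a : Fin 2, ∑ b : Fin 2, (-1 : ℝ) ^ ((a : ℕ) + (b : ℕ)) * S.prob a b x y

/-- The CHSH value `⟨A₀B₀₀⟩ + ⟨A₀B₁₀⟩ + ⟨A₁B₀₁⟩ - ⟨A₁B₁₁⟩`. -/
def chsh (S : Strategy HA HB) : ℝ :=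
  S.correlator 0 0 + S.correlator 0 1 + S.correlator 1 0 - S.correlator 1 1

/-- The leakage constraint `‖B_{y,0} - B_{y,1}‖ ≤ 2κ` for both `y`, in operator norm. -/
def HasLeakage (S : Strategy HA HB) (κ : ℝ) : Prop :=
  ∀ y, ‖(S.bob y 0).observable - (S.bob y 1).observable‖ ≤ 2 * κ

end Strategy

/-- All CHSH values of quantum strategies, on arbitrary Hilbert spaces, under leakage `κ`. -/
def chshValues (κ : ℝ) : Set ℝ :=
  {s | ∃ (HA : Type u) (_ : NormedAddCommGroup HA) (_ : InnerProductSpace ℂ HA)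
      (_ : CompleteSpace HA)
      (HB : Type v) (_ : NormedAddCommGroup HB) (_ : InnerProductSpace ℂ HB)
      (_ : CompleteSpace HB)
      (S : Strategy HA HB), S.HasLeakage κ ∧ S.chsh = s}

/-- The Hilbert space `ℂ²`. -/
abbrev Qubit : Type := EuclideanSpace ℂ (Fin 2)

/-- The computational basis vectors `|0⟩`, `|1⟩`. -/
def ket (i : Fin 2) : Qubit := EuclideanSpace.single i 1

def σx : Qubit →L[ℂ] Qubit := Matrix.toEuclideanCLM (𝕜 := ℂ) !![0, 1; 1, 0]

def σz : Qubit →L[ℂ] Qubit := Matrix.toEuclideanCLM (𝕜 := ℂ) !![1, 0; 0, -1]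

/-- The vector `(|00⟩ + |11⟩) / √2`. -/
def phiPlus : HilbertTensor Qubit Qubit :=
  (((1 / √2 : ℝ) : ℂ) • (ket 0 ⊗ₜ[ℂ] ket 0 + ket 1 ⊗ₜ[ℂ] ket 1) : Qubit ⊗[ℂ] Qubit)

theorem norm_phiPlus : ‖phiPlus‖ = 1 := by
  have h : ‖(ket 0 ⊗ₜ[ℂ] ket 0 + ket 1 ⊗ₜ[ℂ] ket 1 : Qubit ⊗[ℂ] Qubit)‖ = √2 := by
    rw [@norm_eq_sqrt_re_inner ℂ, inner_add_left, inner_add_right, inner_add_right]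
    congr 1
    simp [-inner_self_eq_norm_sq_to_K, TensorProduct.inner_tmul, ket, EuclideanSpace.inner_single_left]
    norm_num
  rw [phiPlus, UniformSpace.Completion.norm_coe, norm_smul, h, Complex.norm_real,
    Real.norm_of_nonneg (by positivity)]
  field_simp

end LeakyCHSH

end

/-!
For a unit vector `ψ` put `b_{y,x} = (1 ⊗ B_{y,x}) ψ`. Since `‖A_x‖ ≤ 1`, the CHSH operator has
expectation at most `‖b₀₀ + b₁₀‖ + ‖b₀₁ - b₁₁‖`, whose square is at most
`2 (4 + 2 (re ⟪b₀₀, b₁₀⟫ - re ⟪b₀₁, b₁₁⟫))`. Leakage enters only through this change of overlap: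
if `‖b_{y,0} - b_{y,1}‖ = 2 sin α_y`, then the overlap changes by at most `2 sin (α₀ + α₁)`, and
`α₀ + α₁ ≤ 2 arcsin κ ≤ π / 2` gives the bound `4 κ √(1 - κ²)`.

The bound is attained on `φ⁺`, where the real combinations `a₁ σx + a₂ σz` have the correlations of
plane vectors, by letting the leaked input interchange the two coefficients of Bob's observable.
For `κ ≥ 1 / √2` the same strategy with coefficients `0` and `1` reaches the algebraic maximum `4`.
-/

namespace LeakyCHSH

section InnerProductSpace

variable {𝕜 H : Type*} [RCLike 𝕜] [NormedAddCommGroup H] [InnerProductSpace 𝕜 H]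

theorem abs_re_inner_apply_le_opNorm (T : H →L[𝕜] H) {x : H} (hx : ‖x‖ = 1) :
    |RCLike.re ⟪x, T x⟫_𝕜| ≤ ‖T‖ :=
  calc |RCLike.re ⟪x, T x⟫_𝕜| ≤ ‖x‖ * ‖T x‖ :=
        (RCLike.abs_re_le_norm _).trans (norm_inner_le_norm _ _)
    _ = ‖T x‖ := by rw [hx, one_mul]
    _ ≤ ‖T‖ := T.unit_le_opNorm x hx.le

theorem norm_le_one_of_abs_reApplyInnerSelf_le {T : H →L[𝕜] H} (hT : T.IsSymmetric)
    (h : ∀ x, |T.reApplyInnerSelf x| ≤ ‖x‖ ^ 2) : ‖T‖ ≤ 1 := by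
  rw [T.norm_eq_iSup_rayleighQuotient hT]
  refine Real.iSup_le (fun x => ?_) zero_le_one
  rw [abs_div, abs_sq]
  exact div_le_one_of_le₀ (h x) (sq_nonneg _)

theorem isPositive_one_add {T : H →L[𝕜] H} (hT : T.IsSymmetric) (hT1 : ‖T‖ ≤ 1) :
    (1 + T).IsPositive := by
  refine ⟨LinearMap.IsSymmetric.id.add hT, fun x => ?_⟩
  have hTx : |RCLike.re ⟪T x, x⟫_𝕜| ≤ ‖x‖ ^ 2 :=
    calc |RCLike.re ⟪T x, x⟫_𝕜| ≤ ‖T x‖ * ‖x‖ :=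
          (RCLike.abs_re_le_norm _).trans (norm_inner_le_norm _ _)
      _ ≤ 1 * ‖x‖ * ‖x‖ := by gcongr; exact T.le_of_opNorm_le hT1 x
      _ = ‖x‖ ^ 2 := by ring
  rw [ContinuousLinearMap.reApplyInnerSelf_apply, add_apply, one_apply_eq_self, inner_add_left,
    map_add, inner_self_eq_norm_sq]
  linarith [(abs_le.1 hTx).1]

theorem sq_half_norm_add_add_sq_half_norm_sub_le_one (𝕜 : Type*) {H : Type*} [RCLike 𝕜]
    [NormedAddCommGroup H] [InnerProductSpace 𝕜 H]
    {x y : H} (hx : ‖x‖ ≤ 1) (hy : ‖y‖ ≤ 1) :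
    (‖x + y‖ / 2) ^ 2 + (‖x - y‖ / 2) ^ 2 ≤ 1 := by
  have hx2 := mul_le_one₀ hx (norm_nonneg x) hx
  have hy2 := mul_le_one₀ hy (norm_nonneg y) hy
  linear_combination parallelogram_law_with_norm 𝕜 x y / 4 + hx2 / 2 + hy2 / 2

theorem norm_add_sq_add_norm_sub_sq_le {x x' y y' : H}
    (hx : ‖x‖ ≤ 1) (hx' : ‖x'‖ ≤ 1) (hy : ‖y‖ ≤ 1) (hy' : ‖y'‖ ≤ 1) :
    ‖x + y‖ ^ 2 + ‖x' - y'‖ ^ 2 ≤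
      4 + 2 * (RCLike.re ⟪x, y⟫_𝕜 - RCLike.re ⟪x', y'⟫_𝕜) := by
  rw [norm_add_sq (𝕜 := 𝕜), norm_sub_sq (𝕜 := 𝕜)]
  have hsq {z : H} (hz : ‖z‖ ≤ 1) : ‖z‖ ^ 2 ≤ 1 := pow_le_one₀ (norm_nonneg z) hz
  linarith [hsq hx, hsq hx', hsq hy, hsq hy']

theorem two_mul_re_inner_sub_re_inner_le (x x' y y' : H) :
    2 * (RCLike.re ⟪x, y⟫_𝕜 - RCLike.re ⟪x', y'⟫_𝕜) ≤
      ‖x + x'‖ * ‖y - y'‖ + ‖x - x'‖ * ‖y + y'‖ := by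
  have hadd := re_inner_le_norm (𝕜 := 𝕜) (x + x') (y - y')
  have hsub := re_inner_le_norm (𝕜 := 𝕜) (x - x') (y + y')
  simp only [inner_add_left, inner_sub_left, inner_add_right, inner_sub_right, map_add,
    map_sub] at hadd hsub
  linarith

end InnerProductSpace

section LeakageInequality

theorem one_div_sqrt_two_le_one : 1 / √2 ≤ 1 :=
  div_le_one_of_le₀ (Real.one_le_sqrt.2 one_le_two) (Real.sqrt_nonneg 2)

theorem sq_add_sqrt_one_sub_sq_sq {κ : ℝ} (hκ0 : 0 ≤ κ) (hκ1 : κ ≤ 1) :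
    κ ^ 2 + √(1 - κ ^ 2) ^ 2 = 1 := by
  rw [Real.sq_sqrt (sub_nonneg.2 (pow_le_one₀ hκ0 hκ1)), add_sub_cancel]

theorem arcsin_le_pi_div_four {κ : ℝ} (hκ : κ ≤ 1 / √2) : Real.arcsin κ ≤ Real.pi / 4 := by
  refine (Real.arcsin_le_iff_le_sin' ⟨?_, ?_⟩).2 ?_
  · linarith [Real.pi_pos]
  · linarith [Real.pi_pos]
  · rwa [Real.sin_pi_div_four, Real.sqrt_div_self, ← one_div]

/- With `d = sin α`, `d' = sin β` and `κ = sin θ`, the left side is at most `sin (α + β)` and the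
right side is `sin (2 * θ)`. -/
theorem mul_add_mul_le_two_mul_mul_sqrt {κ m d m' d' : ℝ} (hκ : κ ≤ 1 / √2)
    (hd : 0 ≤ d) (hd' : 0 ≤ d') (hmd : m ^ 2 + d ^ 2 ≤ 1) (hmd' : m' ^ 2 + d' ^ 2 ≤ 1)
    (hdκ : d ≤ κ) (hdκ' : d' ≤ κ) :
    m * d' + d * m' ≤ 2 * κ * √(1 - κ ^ 2) := by
  have hsin {t : ℝ} (ht : 0 ≤ t) (htκ : t ≤ κ) : Real.sin (Real.arcsin t) = t :=
    Real.sin_arcsin (by linarith) ((htκ.trans hκ).trans one_div_sqrt_two_le_one)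
  have hcos {c t : ℝ} (h : c ^ 2 + t ^ 2 ≤ 1) : c ≤ Real.cos (Real.arcsin t) := by
    rw [Real.cos_arcsin]
    exact Real.le_sqrt_of_sq_le (by linarith)
  have hθ := arcsin_le_pi_div_four hκ
  have hα := Real.arcsin_le_arcsin hdκ
  have hβ := Real.arcsin_le_arcsin hdκ'
  calc m * d' + d * m'
      ≤ Real.cos (Real.arcsin d) * d' + d * Real.cos (Real.arcsin d') := by
        gcongr
        exacts [hcos hmd, hcos hmd']
    _ = Real.sin (Real.arcsin d + Real.arcsin d') := by
        rw [Real.sin_add, hsin hd hdκ, hsin hd' hdκ', add_comm]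
    _ ≤ Real.sin (2 * Real.arcsin κ) :=
        Real.sin_le_sin_of_le_of_le_pi_div_two
          (by linarith [Real.arcsin_nonneg.2 hd, Real.arcsin_nonneg.2 hd', Real.pi_pos])
          (by linarith) (by linarith)
    _ = 2 * κ * √(1 - κ ^ 2) := by
        rw [Real.sin_two_mul, hsin (hd.trans hdκ) le_rfl, Real.cos_arcsin]

variable {𝕜 H : Type*} [RCLike 𝕜] [NormedAddCommGroup H] [InnerProductSpace 𝕜 H]

theorem re_inner_sub_re_inner_le_of_norm_sub_le {κ : ℝ} (hκ : κ ≤ 1 / √2) {x x' y y' : H}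
    (hx : ‖x‖ ≤ 1) (hx' : ‖x'‖ ≤ 1) (hy : ‖y‖ ≤ 1) (hy' : ‖y'‖ ≤ 1)
    (hxx' : ‖x - x'‖ ≤ 2 * κ) (hyy' : ‖y - y'‖ ≤ 2 * κ) :
    RCLike.re ⟪x, y⟫_𝕜 - RCLike.re ⟪x', y'⟫_𝕜 ≤ 4 * κ * √(1 - κ ^ 2) := by
  have hpolar := two_mul_re_inner_sub_re_inner_le (𝕜 := 𝕜) x x' y y'
  have hangle := mul_add_mul_le_two_mul_mul_sqrt (d := ‖x - x'‖ / 2) (d' := ‖y - y'‖ / 2) hκ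
    (by positivity) (by positivity) (sq_half_norm_add_add_sq_half_norm_sub_le_one 𝕜 hx hx')
    (sq_half_norm_add_add_sq_half_norm_sub_le_one 𝕜 hy hy') (by linarith) (by linarith)
  linarith

theorem norm_add_add_norm_sub_le_of_norm_sub_le (𝕜 : Type*) {H : Type*} [RCLike 𝕜]
    [NormedAddCommGroup H] [InnerProductSpace 𝕜 H]
    {κ : ℝ} (hκ : κ ≤ 1 / √2) {x x' y y' : H}
    (hx : ‖x‖ ≤ 1) (hx' : ‖x'‖ ≤ 1) (hy : ‖y‖ ≤ 1) (hy' : ‖y'‖ ≤ 1)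
    (hxx' : ‖x - x'‖ ≤ 2 * κ) (hyy' : ‖y - y'‖ ≤ 2 * κ) :
    ‖x + y‖ + ‖x' - y'‖ ≤ 2 * √2 * (κ + √(1 - κ ^ 2)) := by
  have hκ0 : 0 ≤ κ := by linarith [norm_nonneg (x - x')]
  have hs := sq_add_sqrt_one_sub_sq_sq hκ0 (hκ.trans one_div_sqrt_two_le_one)
  have hoverlap := re_inner_sub_re_inner_le_of_norm_sub_le (𝕜 := 𝕜) hκ hx hx' hy hy' hxx' hyy'
  refine le_of_sq_le_sq ?_ (by positivity)
  calc (‖x + y‖ + ‖x' - y'‖) ^ 2 ≤ 2 * (‖x + y‖ ^ 2 + ‖x' - y'‖ ^ 2) := add_sq_le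
    _ ≤ 2 * (4 + 2 * (4 * κ * √(1 - κ ^ 2))) := by
        linarith [norm_add_sq_add_norm_sub_sq_le (𝕜 := 𝕜) hx hx' hy hy']
    _ = 8 * (κ + √(1 - κ ^ 2)) ^ 2 := by linear_combination -8 * hs
    _ = (2 * √2 * (κ + √(1 - κ ^ 2))) ^ 2 := by
        rw [mul_pow, mul_pow, Real.sq_sqrt zero_le_two]; ring

end LeakageInequality

section TensorOperators

variable {HA HB : Type*} [NormedAddCommGroup HA] [InnerProductSpace ℂ HA]
  [NormedAddCommGroup HB] [InnerProductSpace ℂ HB]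

theorem opTensor_coe (S : HA →L[ℂ] HA) (T : HB →L[ℂ] HB) (x : HA ⊗[ℂ] HB) :
    opTensor S T (x : HilbertTensor HA HB) = (TensorProduct.mapL S T x : HA ⊗[ℂ] HB) :=
  ContinuousLinearMap.completion_apply_coe _ _

theorem hilbertTensor_clm_ext {S T : HilbertTensor HA HB →L[ℂ] HilbertTensor HA HB}
    (h : ∀ x : HA ⊗[ℂ] HB, S (x : HilbertTensor HA HB) = T (x : HilbertTensor HA HB)) : S = T :=
  DFunLike.coe_injective (UniformSpace.Completion.ext S.continuous T.continuous h)

theorem opTensor_add_left (S S' : HA →L[ℂ] HA) (T : HB →L[ℂ] HB) :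
    opTensor (S + S') T = opTensor S T + opTensor S' T :=
  hilbertTensor_clm_ext fun x => by
    simp only [add_apply, opTensor_coe, TensorProduct.mapL_add_left,
      UniformSpace.Completion.coe_add]

theorem opTensor_add_right (S : HA →L[ℂ] HA) (T T' : HB →L[ℂ] HB) :
    opTensor S (T + T') = opTensor S T + opTensor S T' :=
  hilbertTensor_clm_ext fun x => by
    simp only [add_apply, opTensor_coe, TensorProduct.mapL_add_right,
      UniformSpace.Completion.coe_add]

theorem opTensor_sub_left (S S' : HA →L[ℂ] HA) (T : HB →L[ℂ] HB) :
    opTensor (S - S') T = opTensor S T - opTensor S' T := by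
  rw [eq_sub_iff_add_eq, ← opTensor_add_left, sub_add_cancel]

theorem opTensor_sub_right (S : HA →L[ℂ] HA) (T T' : HB →L[ℂ] HB) :
    opTensor S (T - T') = opTensor S T - opTensor S T' := by
  rw [eq_sub_iff_add_eq, ← opTensor_add_right, sub_add_cancel]

theorem opTensor_one_mul_one_opTensor (S : HA →L[ℂ] HA) (T : HB →L[ℂ] HB) :
    opTensor S 1 * opTensor 1 T = opTensor S T :=
  hilbertTensor_clm_ext fun x => by
    rw [mul_apply_eq_comp, opTensor_coe, opTensor_coe, opTensor_coe, ← mul_apply_eq_comp,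
      ← TensorProduct.mapL_mul, mul_one, one_mul]

theorem norm_opTensor_le (S : HA →L[ℂ] HA) (T : HB →L[ℂ] HB) :
    ‖opTensor S T‖ ≤ ‖S‖ * ‖T‖ := by
  refine ContinuousLinearMap.opNorm_le_bound _ (by positivity) fun x => ?_
  induction x using UniformSpace.Completion.induction_on with
  | hp => exact isClosed_le (by fun_prop) (by fun_prop)
  | ih x =>
    rw [opTensor_coe, UniformSpace.Completion.norm_coe, UniformSpace.Completion.norm_coe]
    exact ContinuousLinearMap.le_of_opNorm_le _ (TensorProduct.norm_mapL_le S T) x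

theorem norm_opTensor_one_left_apply_le {T : HB →L[ℂ] HB} {c : ℝ} (hT : ‖T‖ ≤ c)
    {ψ : HilbertTensor HA HB} (hψ : ‖ψ‖ = 1) : ‖opTensor (1 : HA →L[ℂ] HA) T ψ‖ ≤ c :=
  calc ‖opTensor (1 : HA →L[ℂ] HA) T ψ‖ ≤ ‖opTensor (1 : HA →L[ℂ] HA) T‖ :=
        ContinuousLinearMap.unit_le_opNorm _ ψ hψ.le
    _ ≤ ‖(1 : HA →L[ℂ] HA)‖ * ‖T‖ := norm_opTensor_le _ _
    _ ≤ ‖T‖ := mul_le_of_le_one_left (norm_nonneg T) ContinuousLinearMap.norm_id_le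
    _ ≤ c := hT

theorem re_inner_opTensor_apply_le {S : HA →L[ℂ] HA} (hS : ‖S‖ ≤ 1) (T : HB →L[ℂ] HB)
    {ψ : HilbertTensor HA HB} (hψ : ‖ψ‖ = 1) :
    (⟪ψ, opTensor S T ψ⟫_ℂ).re ≤ ‖opTensor (1 : HA →L[ℂ] HA) T ψ‖ := by
  have hS1 : ‖opTensor S (1 : HB →L[ℂ] HB)‖ ≤ 1 :=
    (norm_opTensor_le S 1).trans (mul_le_one₀ hS (norm_nonneg _) ContinuousLinearMap.norm_id_le)
  calc (⟪ψ, opTensor S T ψ⟫_ℂ).re ≤ ‖ψ‖ * ‖opTensor S T ψ‖ := re_inner_le_norm (𝕜 := ℂ) _ _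
    _ = ‖opTensor S 1 (opTensor 1 T ψ)‖ := by
        rw [hψ, one_mul, ← opTensor_one_mul_one_opTensor, mul_apply_eq_comp]
    _ ≤ ‖opTensor 1 T ψ‖ := by
        simpa only [one_mul] using ContinuousLinearMap.le_of_opNorm_le _ hS1 (opTensor 1 T ψ)

end TensorOperators

section States

variable {H : Type*} [NormedAddCommGroup H] [InnerProductSpace ℂ H]

theorem MixedState.summable_expect (ρ : MixedState H) (T : H →L[ℂ] H) :
    Summable fun k => ρ.weight k * (⟪ρ.vec k, T (ρ.vec k)⟫_ℂ).re := by
  refine Summable.of_norm_bounded (ρ.hasSum_weight.summable.mul_right ‖T‖) fun k => ?_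
  rw [norm_mul, Real.norm_of_nonneg (ρ.weight_nonneg k), Real.norm_eq_abs]
  exact mul_le_mul_of_nonneg_left (abs_re_inner_apply_le_opNorm T (ρ.norm_vec k))
    (ρ.weight_nonneg k)

theorem MixedState.expect_add (ρ : MixedState H) (S T : H →L[ℂ] H) :
    ρ.expect (S + T) = ρ.expect S + ρ.expect T := by
  rw [expect, expect, expect, ← (ρ.summable_expect S).tsum_add (ρ.summable_expect T)]
  simp only [add_apply, inner_add_right, Complex.add_re, mul_add]

theorem MixedState.expect_sub (ρ : MixedState H) (S T : H →L[ℂ] H) :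
    ρ.expect (S - T) = ρ.expect S - ρ.expect T := by
  rw [eq_sub_iff_add_eq, ← expect_add, sub_add_cancel]

theorem MixedState.expect_le (ρ : MixedState H) {T : H →L[ℂ] H} {c : ℝ}
    (h : ∀ ψ : H, ‖ψ‖ = 1 → (⟪ψ, T ψ⟫_ℂ).re ≤ c) : ρ.expect T ≤ c :=
  calc ρ.expect T ≤ ∑' k, ρ.weight k * c :=
        (ρ.summable_expect T).tsum_le_tsum
          (fun k => mul_le_mul_of_nonneg_left (h _ (ρ.norm_vec k)) (ρ.weight_nonneg k))
          (ρ.hasSum_weight.summable.mul_right c)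
    _ = c := by rw [tsum_mul_right, ρ.hasSum_weight.tsum_eq, one_mul]

theorem MixedState.expect_pure {ψ : H} (hψ : ‖ψ‖ = 1) (T : H →L[ℂ] H) :
    (MixedState.pure ψ hψ).expect T = (⟪ψ, T ψ⟫_ℂ).re := by
  rw [expect, tsum_eq_single 0 fun k hk => by simp [pure, hk]]
  simp [pure]

end States

section Measurements

variable {H : Type*} [NormedAddCommGroup H] [InnerProductSpace ℂ H]

theorem BinaryPOVM.observable_eq_sub (P : BinaryPOVM H) :
    P.observable = P.effect 0 - P.effect 1 := by
  simp [observable, Fin.sum_univ_two, sub_eq_add_neg]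

theorem BinaryPOVM.isSymmetric_observable (P : BinaryPOVM H) : P.observable.IsSymmetric := by
  rw [observable_eq_sub]
  exact (P.isPositive_effect 0).isSymmetric.sub (P.isPositive_effect 1).isSymmetric

theorem BinaryPOVM.reApplyInnerSelf_effect_add (P : BinaryPOVM H) (x : H) :
    (P.effect 0).reApplyInnerSelf x + (P.effect 1).reApplyInnerSelf x = ‖x‖ ^ 2 := by
  simp only [ContinuousLinearMap.reApplyInnerSelf_apply]
  rw [← map_add, ← inner_add_left, ← add_apply, ← Fin.sum_univ_two P.effect, P.sum_effect,
    one_apply_eq_self, inner_self_eq_norm_sq]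

theorem BinaryPOVM.norm_observable_le_one (P : BinaryPOVM H) : ‖P.observable‖ ≤ 1 := by
  refine norm_le_one_of_abs_reApplyInnerSelf_le P.isSymmetric_observable fun x => ?_
  have hsub : P.observable.reApplyInnerSelf x =
      (P.effect 0).reApplyInnerSelf x - (P.effect 1).reApplyInnerSelf x := by
    simp only [observable_eq_sub, ContinuousLinearMap.reApplyInnerSelf_apply, sub_apply,
      inner_sub_left, map_sub]
  have h0 := (P.isPositive_effect 0).2 x
  have h1 := (P.isPositive_effect 1).2 x
  have hsum := P.reApplyInnerSelf_effect_add x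
  rw [hsub]
  exact abs_sub_le_of_nonneg_of_le h0 (by linarith) h1 (by linarith)

open scoped ComplexOrder in
/-- The two-outcome measurement with effects `(1 ± T) / 2`, whose observable is a given symmetric
contraction `T`. -/
noncomputable def BinaryPOVM.ofObservable (T : H →L[ℂ] H) (hT : T.IsSymmetric) (hT1 : ‖T‖ ≤ 1) :
    BinaryPOVM H where
  effect := ![(1 / 2 : ℂ) • (1 + T), (1 / 2 : ℂ) • (1 + -T)]
  isPositive_effect b := by
    have half_nonneg : (0 : ℂ) ≤ 1 / 2 := by positivity
    have hneg : (-T).IsSymmetric := fun x y => by simpa using hT x y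
    fin_cases b
    · exact (isPositive_one_add hT hT1).smul_of_nonneg half_nonneg
    · exact (isPositive_one_add hneg (by rwa [norm_neg])).smul_of_nonneg half_nonneg
  sum_effect := by
    simp only [Fin.sum_univ_two, Matrix.cons_val_zero, Matrix.cons_val_one]
    module

theorem BinaryPOVM.observable_ofObservable {T : H →L[ℂ] H} (hT : T.IsSymmetric) (hT1 : ‖T‖ ≤ 1) :
    (ofObservable T hT hT1).observable = T := by
  rw [observable_eq_sub]
  simp only [ofObservable, Matrix.cons_val_zero, Matrix.cons_val_one]
  module

end Measurements

namespace Strategy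

variable {HA HB : Type*} [NormedAddCommGroup HA] [InnerProductSpace ℂ HA]
  [NormedAddCommGroup HB] [InnerProductSpace ℂ HB]

theorem correlator_eq_expect (S : Strategy HA HB) (x y : Fin 2) :
    S.correlator x y =
      S.state.expect (opTensor (S.alice x).observable (S.bob y x).observable) := by
  simp only [correlator, prob, Fin.sum_univ_two, BinaryPOVM.observable_eq_sub, opTensor_sub_left,
    opTensor_sub_right, MixedState.expect_sub, Fin.val_zero, Fin.val_one]
  ring

theorem chsh_eq_expect (S : Strategy HA HB) :
    S.chsh = S.state.expect
      (opTensor (S.alice 0).observable ((S.bob 0 0).observable + (S.bob 1 0).observable) +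
        opTensor (S.alice 1).observable ((S.bob 0 1).observable - (S.bob 1 1).observable)) := by
  simp only [chsh, correlator_eq_expect, opTensor_add_right, opTensor_sub_right,
    MixedState.expect_add, MixedState.expect_sub]
  ring

/-- The vector `(1 ⊗ B_{y,x}) ψ` of Bob's observable acting on a vector of the composite system. -/
noncomputable def bobVec (S : Strategy HA HB) (ψ : HilbertTensor HA HB) (y x : Fin 2) :
    HilbertTensor HA HB :=
  opTensor 1 (S.bob y x).observable ψ

theorem norm_bobVec_le_one (S : Strategy HA HB) {ψ : HilbertTensor HA HB} (hψ : ‖ψ‖ = 1)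
    (y x : Fin 2) : ‖S.bobVec ψ y x‖ ≤ 1 :=
  norm_opTensor_one_left_apply_le (S.bob y x).norm_observable_le_one hψ

theorem HasLeakage.norm_bobVec_sub_le {S : Strategy HA HB} {κ : ℝ} (hS : S.HasLeakage κ)
    {ψ : HilbertTensor HA HB} (hψ : ‖ψ‖ = 1) (y : Fin 2) :
    ‖S.bobVec ψ y 0 - S.bobVec ψ y 1‖ ≤ 2 * κ := by
  rw [bobVec, bobVec, ← sub_apply, ← opTensor_sub_right]
  exact norm_opTensor_one_left_apply_le (hS y) hψ

theorem chsh_le_of_norm_bobVec_le (S : Strategy HA HB) {c : ℝ}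
    (h : ∀ ψ, ‖ψ‖ = 1 →
      ‖S.bobVec ψ 0 0 + S.bobVec ψ 1 0‖ + ‖S.bobVec ψ 0 1 - S.bobVec ψ 1 1‖ ≤ c) :
    S.chsh ≤ c := by
  rw [chsh_eq_expect]
  refine S.state.expect_le fun ψ hψ => (h ψ hψ).trans' ?_
  rw [add_apply, inner_add_right, Complex.add_re]
  simp only [bobVec, ← add_apply, ← sub_apply, ← opTensor_add_right, ← opTensor_sub_right]
  gcongr <;> exact re_inner_opTensor_apply_le (BinaryPOVM.norm_observable_le_one _) _ hψ

theorem HasLeakage.chsh_le {S : Strategy HA HB} {κ : ℝ} (hS : S.HasLeakage κ)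
    (hκ : κ ≤ 1 / √2) : S.chsh ≤ 2 * √2 * (κ + √(1 - κ ^ 2)) :=
  S.chsh_le_of_norm_bobVec_le fun _ hψ =>
    norm_add_add_norm_sub_le_of_norm_sub_le ℂ hκ
      (S.norm_bobVec_le_one hψ 0 0) (S.norm_bobVec_le_one hψ 0 1)
      (S.norm_bobVec_le_one hψ 1 0) (S.norm_bobVec_le_one hψ 1 1)
      (hS.norm_bobVec_sub_le hψ 0) (hS.norm_bobVec_sub_le hψ 1)

theorem chsh_le_four (S : Strategy HA HB) : S.chsh ≤ 4 :=
  S.chsh_le_of_norm_bobVec_le fun _ hψ => by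
    have hadd := norm_add_le_of_le (S.norm_bobVec_le_one hψ 0 0) (S.norm_bobVec_le_one hψ 1 0)
    have hsub := norm_sub_le_of_le (S.norm_bobVec_le_one hψ 0 1) (S.norm_bobVec_le_one hψ 1 1)
    linarith

end Strategy

theorem mem_upperBounds_chshValues {κ : ℝ} (hκ : κ ≤ 1 / √2) :
    2 * √2 * (κ + √(1 - κ ^ 2)) ∈ upperBounds (chshValues.{u, v} κ) := by
  rintro _ ⟨HA, _, _, _, HB, _, _, _, S, hS, rfl⟩
  exact hS.chsh_le hκ

theorem four_mem_upperBounds_chshValues (κ : ℝ) : 4 ∈ upperBounds (chshValues.{u, v} κ) := by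
  rintro _ ⟨HA, _, _, _, HB, _, _, _, S, -, rfl⟩
  exact S.chsh_le_four

theorem Strategy.HasLeakage.chsh_mem_chshValues {HA : Type u} [NormedAddCommGroup HA]
    [InnerProductSpace ℂ HA] [CompleteSpace HA] {HB : Type v} [NormedAddCommGroup HB]
    [InnerProductSpace ℂ HB] [CompleteSpace HB] {S : Strategy HA HB} {κ : ℝ}
    (hS : S.HasLeakage κ) : S.chsh ∈ chshValues.{u, v} κ :=
  ⟨HA, _, _, ‹_›, HB, _, _, ‹_›, S, hS, rfl⟩

section MaximallyEntangledState

open Matrix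

theorem inner_ket_toEuclideanCLM_ket (M : Matrix (Fin 2) (Fin 2) ℂ) (i j : Fin 2) :
    ⟪ket i, toEuclideanCLM (𝕜 := ℂ) M (ket j)⟫_ℂ = M i j := by
  simp [ket, EuclideanSpace.inner_single_left]

theorem expect_phiPlus_toEuclideanCLM (M N : Matrix (Fin 2) (Fin 2) ℂ) :
    (MixedState.pure phiPlus norm_phiPlus).expect
      (opTensor (toEuclideanCLM (𝕜 := ℂ) M) (toEuclideanCLM (𝕜 := ℂ) N)) =
        (Mᵀ * N).trace.re / 2 := by
  set Φ : Qubit ⊗[ℂ] Qubit := ket 0 ⊗ₜ[ℂ] ket 0 + ket 1 ⊗ₜ[ℂ] ket 1 with hΦ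
  have hphi : phiPlus = ((1 / √2 : ℝ) : ℂ) • (Φ : HilbertTensor Qubit Qubit) :=
    UniformSpace.Completion.coe_smul _ _
  have htrace : ⟪Φ, TensorProduct.mapL (toEuclideanCLM (𝕜 := ℂ) M)
      (toEuclideanCLM (𝕜 := ℂ) N) Φ⟫_ℂ = (Mᵀ * N).trace := by
    simp only [hΦ, map_add, TensorProduct.mapL_tmul, inner_add_left, inner_add_right,
      TensorProduct.inner_tmul, inner_ket_toEuclideanCLM_ket, trace_fin_two, mul_apply,
      transpose_apply, Fin.sum_univ_two]
  have hsq : 1 / √2 * (1 / √2) = 1 / 2 := by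
    rw [div_mul_div_comm, Real.mul_self_sqrt zero_le_two, one_mul]
  rw [MixedState.expect_pure, hphi, map_smul, inner_smul_left, inner_smul_right, opTensor_coe,
    UniformSpace.Completion.inner_coe, htrace, Complex.conj_ofReal, ← mul_assoc,
    ← Complex.ofReal_mul, hsq, Complex.re_ofReal_mul]
  ring

/-- The qubit observable `α σx + β σz`, standing for the plane vector `(α, β)`. -/
noncomputable def pauliXZ (α β : ℝ) : Qubit →L[ℂ] Qubit := (α : ℂ) • σx + (β : ℂ) • σz

theorem pauliXZ_one_zero : pauliXZ 1 0 = σx := by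
  rw [pauliXZ, Complex.ofReal_zero, Complex.ofReal_one]; module

theorem pauliXZ_zero_one : pauliXZ 0 1 = σz := by
  rw [pauliXZ, Complex.ofReal_zero, Complex.ofReal_one]; module

theorem pauliXZ_neg_one_zero : pauliXZ (-1) 0 = -σx := by
  rw [pauliXZ, Complex.ofReal_zero, Complex.ofReal_neg, Complex.ofReal_one]; module

theorem pauliXZ_sub (α β γ δ : ℝ) : pauliXZ α β - pauliXZ γ δ = pauliXZ (α - γ) (β - δ) := by
  simp only [pauliXZ, Complex.ofReal_sub]
  module

theorem pauliXZ_eq_toEuclideanCLM (α β : ℝ) :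
    pauliXZ α β = toEuclideanCLM (𝕜 := ℂ) !![(β : ℂ), α; α, -β] := by
  rw [pauliXZ, σx, σz, ← map_smul (toEuclideanCLM (n := Fin 2) (𝕜 := ℂ)),
    ← map_smul (toEuclideanCLM (n := Fin 2) (𝕜 := ℂ)), ← map_add]
  congr 1
  ext i j
  fin_cases i <;> fin_cases j <;> simp

theorem isSelfAdjoint_pauliXZ (α β : ℝ) : IsSelfAdjoint (pauliXZ α β) := by
  rw [pauliXZ_eq_toEuclideanCLM, IsSelfAdjoint, ← map_star]
  congr 1
  ext i j
  fin_cases i <;> fin_cases j <;> simp [star_apply]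

theorem pauliXZ_mul_self (α β : ℝ) :
    pauliXZ α β * pauliXZ α β = ((α ^ 2 + β ^ 2 : ℝ) : ℂ) • 1 := by
  rw [pauliXZ_eq_toEuclideanCLM, ← map_mul, ← map_one (toEuclideanCLM (𝕜 := ℂ)), ← map_smul]
  congr 1
  ext i j
  fin_cases i <;> fin_cases j <;> simp [mul_apply, Fin.sum_univ_two] <;> ring

theorem norm_pauliXZ (α β : ℝ) : ‖pauliXZ α β‖ = √(α ^ 2 + β ^ 2) := by
  rw [eq_comm, Real.sqrt_eq_iff_eq_sq (by positivity) (norm_nonneg _), sq ‖_‖,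
    ← CStarRing.norm_star_mul_self, (isSelfAdjoint_pauliXZ α β).star_eq, pauliXZ_mul_self,
    norm_smul, norm_one, mul_one, Complex.norm_real, Real.norm_of_nonneg (by positivity)]

theorem expect_phiPlus_pauliXZ (α β γ δ : ℝ) :
    (MixedState.pure phiPlus norm_phiPlus).expect (opTensor (pauliXZ α β) (pauliXZ γ δ)) =
      α * γ + β * δ := by
  rw [pauliXZ_eq_toEuclideanCLM, pauliXZ_eq_toEuclideanCLM, expect_phiPlus_toEuclideanCLM]
  simp only [trace_fin_two, mul_apply, transpose_apply, of_apply, cons_val', cons_val_zero,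
    cons_val_fin_one, Fin.sum_univ_two, cons_val_one, mul_neg, neg_mul, neg_neg, Complex.add_re,
    Complex.mul_re, Complex.ofReal_re, Complex.ofReal_im, mul_zero, sub_zero]
  ring

/-- The measurement of the observable `α σx + β σz` given by a unit vector `(α, β)`. -/
noncomputable def pauliXZPOVM (α β : ℝ) (h : α ^ 2 + β ^ 2 = 1) : BinaryPOVM Qubit :=
  .ofObservable (pauliXZ α β) (isSelfAdjoint_pauliXZ α β).isSymmetric
    (by rw [norm_pauliXZ, h, Real.sqrt_one])

theorem observable_pauliXZPOVM (α β : ℝ) (h : α ^ 2 + β ^ 2 = 1) :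
    (pauliXZPOVM α β h).observable = pauliXZ α β :=
  BinaryPOVM.observable_ofObservable _ _

/-- The strategy on `φ⁺` in which Alice measures `σz` and `σx`, while Bob, on input `y`, measures
`± c σx + d σz` or `± d σx + c σz` according to Alice's input, with sign `(-1)^y`. -/
noncomputable def swapStrategy (c d : ℝ) (h : c ^ 2 + d ^ 2 = 1) : Strategy Qubit Qubit where
  state := .pure phiPlus norm_phiPlus
  alice := ![pauliXZPOVM 0 1 (by norm_num), pauliXZPOVM 1 0 (by norm_num)]
  bob := ![![pauliXZPOVM c d h, pauliXZPOVM d c (by linarith)],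
    ![pauliXZPOVM (-c) d (by linarith [neg_sq c]), pauliXZPOVM (-d) c (by linarith [neg_sq d])]]

variable {c d : ℝ} (h : c ^ 2 + d ^ 2 = 1)

theorem observable_alice_zero_swapStrategy : ((swapStrategy c d h).alice 0).observable = σz := by
  simp [swapStrategy, observable_pauliXZPOVM, pauliXZ_zero_one]

theorem observable_alice_one_swapStrategy : ((swapStrategy c d h).alice 1).observable = σx := by
  simp [swapStrategy, observable_pauliXZPOVM, pauliXZ_one_zero]

theorem observable_bob_zero_swapStrategy (x : Fin 2) :
    ((swapStrategy c d h).bob 0 x).observable = ![pauliXZ c d, pauliXZ d c] x := by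
  fin_cases x <;> simp [swapStrategy, observable_pauliXZPOVM]

theorem observable_bob_one_swapStrategy (x : Fin 2) :
    ((swapStrategy c d h).bob 1 x).observable = ![pauliXZ (-c) d, pauliXZ (-d) c] x := by
  fin_cases x <;> simp [swapStrategy, observable_pauliXZPOVM]

theorem hasLeakage_swapStrategy_iff {κ : ℝ} :
    (swapStrategy c d h).HasLeakage κ ↔ √2 * |d - c| ≤ 2 * κ := by
  have hnorm (a : ℝ) (ha : a ^ 2 = (d - c) ^ 2) : ‖pauliXZ a (d - c)‖ = √2 * |d - c| := by
    rw [norm_pauliXZ, ha, ← two_mul, Real.sqrt_mul zero_le_two, Real.sqrt_sq_eq_abs]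
  simp only [Strategy.HasLeakage, Fin.forall_fin_two, observable_bob_zero_swapStrategy,
    observable_bob_one_swapStrategy, cons_val_zero, cons_val_one, pauliXZ_sub]
  rw [hnorm _ (by ring), hnorm _ (by ring), and_self]

theorem chsh_swapStrategy : (swapStrategy c d h).chsh = 4 * d := by
  have hstate : (swapStrategy c d h).state = .pure phiPlus norm_phiPlus := rfl
  simp only [Strategy.chsh, Strategy.correlator_eq_expect, hstate,
    observable_alice_zero_swapStrategy, observable_alice_one_swapStrategy,
    observable_bob_zero_swapStrategy, observable_bob_one_swapStrategy, cons_val_zero,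
    cons_val_one, ← pauliXZ_zero_one, ← pauliXZ_one_zero, expect_phiPlus_pauliXZ]
  ring

theorem hasLeakage_swapStrategy_zero_one {κ : ℝ} (h : (0 : ℝ) ^ 2 + 1 ^ 2 = 1)
    (hκ : 1 / √2 ≤ κ) : (swapStrategy 0 1 h).HasLeakage κ := by
  rw [hasLeakage_swapStrategy_iff]
  calc √2 * |1 - 0| = 2 * (1 / √2) := by rw [sub_zero, abs_one, mul_one, mul_one_div, Real.div_sqrt]
    _ ≤ 2 * κ := by gcongr

/-- The swap strategy whose coefficients are the coordinates of the unit vector `(s, κ)` rotated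
by `π / 4`; with `s = √(1 - κ ^ 2)` it is optimal at leakage `κ`. -/
noncomputable def tiltedStrategy (κ s : ℝ) (hκs : κ ^ 2 + s ^ 2 = 1) : Strategy Qubit Qubit :=
  swapStrategy ((-κ + s) / √2) ((κ + s) / √2) <| by
    rw [div_pow, div_pow, Real.sq_sqrt zero_le_two]
    linarith

variable {κ s : ℝ} (hκs : κ ^ 2 + s ^ 2 = 1)

theorem hasLeakage_tiltedStrategy (hκ : 0 ≤ κ) : (tiltedStrategy κ s hκs).HasLeakage κ := by
  rw [tiltedStrategy, hasLeakage_swapStrategy_iff, ← sub_div, add_sub_add_right_eq_sub,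
    sub_neg_eq_add, abs_of_nonneg (by positivity), mul_div_cancel₀ _ (by positivity), two_mul]

theorem chsh_tiltedStrategy : (tiltedStrategy κ s hκs).chsh = 2 * √2 * (κ + s) := by
  rw [tiltedStrategy, chsh_swapStrategy]
  field_simp
  rw [Real.sq_sqrt zero_le_two]
  ring

end MaximallyEntangledState

end LeakyCHSH

theorem mainTheorem5 (κ : ℝ) (hκ0 : 0 ≤ κ) (hκ1 : κ < 1) :
    (κ ≤ 1 / √2 →
      IsGreatest (LeakyCHSH.chshValues.{0, 0} κ) (2 * √2 * (κ + √(1 - κ ^ 2))) ∧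
      2 * √2 * (κ + √(1 - κ ^ 2)) ∈ upperBounds (LeakyCHSH.chshValues.{u, v} κ) ∧
      ∃ S : LeakyCHSH.Strategy LeakyCHSH.Qubit LeakyCHSH.Qubit,
        S.state = LeakyCHSH.MixedState.pure LeakyCHSH.phiPlus LeakyCHSH.norm_phiPlus ∧
        (S.alice 0).observable = LeakyCHSH.σz ∧
        (S.alice 1).observable = LeakyCHSH.σx ∧
        (S.bob 0 0).observable =
          (((-κ + √(1 - κ ^ 2)) / √2 : ℝ) : ℂ) • LeakyCHSH.σx +
            (((κ + √(1 - κ ^ 2)) / √2 : ℝ) : ℂ) • LeakyCHSH.σz ∧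
        (S.bob 0 1).observable =
          (((κ + √(1 - κ ^ 2)) / √2 : ℝ) : ℂ) • LeakyCHSH.σx +
            (((-κ + √(1 - κ ^ 2)) / √2 : ℝ) : ℂ) • LeakyCHSH.σz ∧
        (S.bob 1 0).observable =
          (((κ - √(1 - κ ^ 2)) / √2 : ℝ) : ℂ) • LeakyCHSH.σx +
            (((κ + √(1 - κ ^ 2)) / √2 : ℝ) : ℂ) • LeakyCHSH.σz ∧
        (S.bob 1 1).observable =
          (((-κ - √(1 - κ ^ 2)) / √2 : ℝ) : ℂ) • LeakyCHSH.σx +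
            (((-κ + √(1 - κ ^ 2)) / √2 : ℝ) : ℂ) • LeakyCHSH.σz ∧
        S.HasLeakage κ ∧
        S.chsh = 2 * √2 * (κ + √(1 - κ ^ 2))) ∧
    (1 / √2 ≤ κ →
      IsGreatest (LeakyCHSH.chshValues.{0, 0} κ) 4 ∧
      4 ∈ upperBounds (LeakyCHSH.chshValues.{u, v} κ) ∧
      ∃ S : LeakyCHSH.Strategy LeakyCHSH.Qubit LeakyCHSH.Qubit,
        S.state = LeakyCHSH.MixedState.pure LeakyCHSH.phiPlus LeakyCHSH.norm_phiPlus ∧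
        (S.alice 0).observable = LeakyCHSH.σz ∧
        (S.alice 1).observable = LeakyCHSH.σx ∧
        (S.bob 0 0).observable = LeakyCHSH.σz ∧
        (S.bob 0 1).observable = LeakyCHSH.σx ∧
        (S.bob 1 0).observable = LeakyCHSH.σz ∧
        (S.bob 1 1).observable = -LeakyCHSH.σx ∧
        S.HasLeakage κ ∧
        S.chsh = 4) := by
  open LeakyCHSH in
  refine ⟨fun hκ => ?_, fun hκ => ?_⟩
  · have hs := sq_add_sqrt_one_sub_sq_sq hκ0 hκ1.le
    have hleak := hasLeakage_tiltedStrategy hs hκ0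
    have hchsh := chsh_tiltedStrategy hs
    exact ⟨⟨hchsh ▸ hleak.chsh_mem_chshValues, mem_upperBounds_chshValues hκ⟩,
      mem_upperBounds_chshValues hκ, tiltedStrategy _ _ hs, rfl,
      observable_alice_zero_swapStrategy _, observable_alice_one_swapStrategy _,
      observable_bob_zero_swapStrategy _ 0, observable_bob_zero_swapStrategy _ 1,
      (observable_bob_one_swapStrategy _ 0).trans (congrArg (pauliXZ · _) (by ring)),
      (observable_bob_one_swapStrategy _ 1).trans (congrArg (pauliXZ · _) (by ring)),
      hleak, hchsh⟩
  · have hunit : (0 : ℝ) ^ 2 + 1 ^ 2 = 1 := by norm_num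
    have hleak := hasLeakage_swapStrategy_zero_one hunit hκ
    have hchsh := (chsh_swapStrategy hunit).trans (mul_one 4)
    exact ⟨⟨hchsh ▸ hleak.chsh_mem_chshValues, four_mem_upperBounds_chshValues κ⟩,
      four_mem_upperBounds_chshValues κ, swapStrategy 0 1 hunit, rfl,
      observable_alice_zero_swapStrategy _, observable_alice_one_swapStrategy _,
      (observable_bob_zero_swapStrategy _ 0).trans pauliXZ_zero_one,
      (observable_bob_zero_swapStrategy _ 1).trans pauliXZ_one_zero,
      (observable_bob_one_swapStrategy _ 0).trans
        ((congrArg (pauliXZ · 1) neg_zero).trans pauliXZ_zero_one),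
      (observable_bob_one_swapStrategy _ 1).trans pauliXZ_neg_one_zero, hleak, hchsh⟩
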